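/- Let $\mathbb{T}^\star\subseteq\mathbb{R}$ be a time scale (a nonempty closed subset of $\mathbb{R}$), with backward jump $\hat\rho$ and nabla derivative $\hat\nabla$. For $\bar A\in\mathbb{R}^{n\times n}$, $\bar B\in\mathbb{R}^{n\times m}$, $\bar C\in\mathbb{R}^{p\times n}$ consider the time-invariant system $$y^{\hat\nabla}(s)=\bar A y(s)+\bar B v(s),\qquad \gamma(s)=\bar C y(s),\qquad s\le s_0,\ s\in(\mathbb{T}^\star)_\kappa ,$$ where $(\mathbb{T}^\star)_\kappa$ is $\mathbb{T}^\star$ without its minimum if that exists and is right-scattered, and is $\mathbb{T}^\star$ otherwise, and where a trajectory $y$ is defined on the time scale $(-\infty,s_0]\cap\mathbb{T}^\star$, with respect to which the nabla derivative is taken. Let $s_1,s_0\in\mathbb{T}^\star$ be such that $[s_1,s_0]\cap\mathbb{T}^\star$ has at least $n+1$ points. The system is called observable on $[s_1,s_0]\cap\mathbb{T}^\star$ if, for every ld-continuous control $v$ on $(-\infty,s_0]\cap\mathbb{T}^\star$, the initial state $y(s_0)$ is uniquely determined by the output $\gamma$ on $(s_1,s_0]\cap\mathbb{T}^\star$: any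 two trajectories $y,z$ under the same control $v$ with $\bar C y(s)=\bar C z(s)$ for all $s\in(s_1,s_0]\cap\mathbb{T}^\star$ satisfy $y(s_0)=z(s_0)$. Let $\lambda_1,\dots,\lambda_n\in\mathbb{C}$ be the eigenvalues of $\bar A$, listed with algebraic multiplicity in any order, and put $\bar P_0=I$, $\bar P_{k+1}=(\bar A-\lambda_{k+1}I)\bar P_k$ for $k=0,\dots,n-1$. Then the following are equivalent: 1. the system is observable on $[s_1,s_0]\cap\mathbb{T}^\star$; 2. $\operatorname{rank}\begin{pmatrix}\bar C\bar P_0\\ \bar C\bar P_1\\ \vdots\\ \bar C\bar P_{n-1}\end{pmatrix}=n$ (rank over $\mathbb{C}$); 3. $\operatorname{rank}\begin{pmatrix}\bar C\\ \bar C\bar A\\ \vdots\\ \bar C\bar A^{n-1}\end{pmatrix}=n$. -/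

import Mathlib

open Set Filter Topology
open scoped Matrix

namespace NablaSystem

/-- A time scale: a nonempty closed subset of the real line. -/
def IsTimeScale (T : Set ℝ) : Prop := T.Nonempty ∧ IsClosed T

open Classical in
/-- Forward jump operator of `T`, with the convention `σ (max T) = max T`. -/
noncomputable def sigma (T : Set ℝ) (s : ℝ) : ℝ :=
  if (T ∩ Ioi s).Nonempty then sInf (T ∩ Ioi s) else s

open Classical in
/-- Backward jump operator of `T`, with the convention `ρ (min T) = min T`. -/
noncomputable def rho (T : Set ℝ) (s : ℝ) : ℝ :=
  if (T ∩ Iio s).Nonempty then sSup (T ∩ Iio s) else s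

/-- The set `T_κ`: the time scale without its minimum, if the latter exists and is right-scattered;
the whole of `T` otherwise. -/
def lowerKappa (T : Set ℝ) : Set ℝ := {s | s ∈ T ∧ ¬ (IsLeast T s ∧ s < sigma T s)}

/-- `f` has nabla derivative `f'` at the point `s` of the time scale `T`.
Only values of `f` on `T` matter. -/
def HasNablaDerivAt {E : Type*} [NormedAddCommGroup E] [NormedSpace ℝ E]
    (T : Set ℝ) (f : ℝ → E) (f' : E) (s : ℝ) : Prop :=
  ∀ ε > 0, ∃ δ > 0, ∀ r ∈ T, |s - r| < δ →
    ‖f (rho T s) - f r - (rho T s - r) • f'‖ ≤ ε * |rho T s - r|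

/-- `f` is ld-continuous on the time scale `T`: continuous (along `T`) at points with `ρ s = s`,
with finite right-sided limits at points with `σ s = s`. (If `T` has a right-dense minimum, `f` is
continuous there too; for an isolated minimum and for the maximum the respective requirements are
automatic.) -/
def LdContinuous {E : Type*} [TopologicalSpace E] (T : Set ℝ) (f : ℝ → E) : Prop :=
  ∀ s ∈ T, (rho T s = s → ContinuousWithinAt f T s) ∧
    (sigma T s = s → ∃ l, Tendsto f (𝓝[T ∩ Ioi s] s) (𝓝 l))

/-- `y` is a backward trajectory, from time `s₀` on, of the time-invariant system
`y^∇ = A y + B v` on `T` under the control `v`: it is defined on `(-∞, s₀] ∩ T` (itself a time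
scale, with respect to which the nabla derivative is taken) and satisfies the equation at all
`s ≤ s₀` in `T_κ`. -/
def IsTrajectory {n m : ℕ} (T : Set ℝ) (A : Matrix (Fin n) (Fin n) ℝ)
    (B : Matrix (Fin n) (Fin m) ℝ) (s₀ : ℝ) (v : ℝ → Fin m → ℝ) (y : ℝ → Fin n → ℝ) : Prop :=
  ∀ s ∈ lowerKappa T, s ≤ s₀ → HasNablaDerivAt (T ∩ Iic s₀) y (A *ᵥ y s + B *ᵥ v s) s

/-- The system `y^∇ = A y + B v`, `γ = C y` is observable on `[s₁, s₀] ∩ T`: for every (known)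
ld-continuous control, the initial state `y s₀` of a trajectory is uniquely determined by its output
`γ = C y` on `(s₁, s₀] ∩ T`. -/
def IsObservableOn {n m p : ℕ} (T : Set ℝ) (A : Matrix (Fin n) (Fin n) ℝ)
    (B : Matrix (Fin n) (Fin m) ℝ) (C : Matrix (Fin p) (Fin n) ℝ) (s₁ s₀ : ℝ) : Prop :=
  ∀ v : ℝ → Fin m → ℝ, LdContinuous (T ∩ Iic s₀) v →
    ∀ y z : ℝ → Fin n → ℝ, IsTrajectory T A B s₀ v y → IsTrajectory T A B s₀ v z →
      (∀ s ∈ T ∩ Ioc s₁ s₀, C *ᵥ y s = C *ᵥ z s) → y s₀ = z s₀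

/-- `lam` lists the complex eigenvalues of the real matrix `A`, with algebraic multiplicities,
in some order. -/
def IsEigenvalueList {n : ℕ} (A : Matrix (Fin n) (Fin n) ℝ) (lam : Fin n → ℂ) : Prop :=
  Multiset.map lam Finset.univ.val = (A.map Complex.ofReal).charpoly.roots

/-- The matrices `P 0 = I`, `P (k + 1) = (A - lam k • I) * P k` for `k = 0, …, n - 1`. The entry
`lam k` is the eigenvalue usually numbered `k + 1`. -/
noncomputable def pMatrix {n : ℕ} (A : Matrix (Fin n) (Fin n) ℝ) (lam : Fin n → ℂ) :
    Fin (n + 1) → Matrix (Fin n) (Fin n) ℂ :=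
  Fin.induction 1 (fun k P => (A.map Complex.ofReal - lam k • 1) * P)

/-- The block column with the `p × n` blocks `M 0, …, M (n - 1)`. -/
def stack {n p : ℕ} {R : Type*} (M : Fin n → Matrix (Fin p) (Fin n) R) :
    Matrix (Fin n × Fin p) (Fin n) R :=
  Matrix.of fun i j => M i.1 i.2 j

end NablaSystem

/-! ### Linear algebra: comparing the two rank conditions. -/

namespace NablaSystem

/-! Both rank conditions say that a stacked matrix has trivial kernel. Each `P k` is a monic
polynomial of degree `k` in `A`, so the two stacks differ by an invertible triangular change of
blocks (`rank_stack_pMatrix_iff`).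

Rank implies observability: the difference `w` of two trajectories with equal output solves `w^∇ = A
w` with `C w = 0` on `(s₁, s₀]`. Differentiating `C A^k w = 0` gives `C A^(k+1) w = 0`, at the price
of one backward jump (`mulVec_pow_trajectory_eq_zero`). Having `n + 1` points in the window pays for
the `n - 1` jumps needed at `s₀`.

Observability implies rank: by Cayley–Hamilton a kernel vector `x` is killed by every `C A^k`. These
vectors form an `A`-invariant subspace; solving `y^∇ = A y`, `y s₀ = x` inside it gives a trajectory
with zero output, indistinguishable from `0`. Solvability backward in time on any time scale is
`exists_hasNablaDerivAt_eq_clm_apply`. -/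

theorem rank_eq_iff_mulVec_injective {ι K : Type*} [Fintype ι] [Field K] {n : ℕ}
    (M : Matrix ι (Fin n) K) : M.rank = n ↔ ∀ x, M *ᵥ x = 0 → x = 0 := by
  have h := LinearMap.finrank_range_add_finrank_ker M.mulVecLin
  rw [Module.finrank_fin_fun] at h
  have h' : M.rank = n ↔ LinearMap.ker M.mulVecLin = ⊥ := by
    rw [← Submodule.finrank_eq_zero, Matrix.rank]
    omega
  rw [h', LinearMap.ker_eq_bot']
  rfl

theorem stack_mulVec_eq_zero {n p : ℕ} {R : Type*} [CommRing R]
    (M : Fin n → Matrix (Fin p) (Fin n) R) (x : Fin n → R) :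
    stack M *ᵥ x = 0 ↔ ∀ k, M k *ᵥ x = 0 := by
  constructor
  · intro h k
    ext i
    exact congrFun h (k, i)
  · intro h
    ext ⟨k, i⟩
    exact congrFun (h k) i

theorem exists_monic_aeval_eq_pMatrix {n : ℕ} (A : Matrix (Fin n) (Fin n) ℝ) (lam : Fin n → ℂ)
    (k : Fin (n + 1)) : ∃ q : Polynomial ℂ, q.Monic ∧ q.natDegree = k ∧
      pMatrix A lam k = Polynomial.aeval (A.map Complex.ofReal) q := by
  induction k using Fin.induction with
  | zero => exact ⟨1, Polynomial.monic_one, by simp, by simp [pMatrix]⟩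
  | succ k ih =>
    obtain ⟨q, hq, hd, he⟩ := ih
    refine ⟨(Polynomial.X - Polynomial.C (lam k)) * q, (Polynomial.monic_X_sub_C _).mul hq, ?_, ?_⟩
    · rw [(Polynomial.monic_X_sub_C _).natDegree_mul hq, hd]
      simp [add_comm]
    · have : pMatrix A lam k.succ = (A.map Complex.ofReal - lam k • 1) * pMatrix A lam k.castSucc := by
        simp [pMatrix]
      rw [this, he]
      simp [Algebra.algebraMap_eq_smul_one]

theorem mul_aeval_mulVec {n p : ℕ} {K : Type*} [Field K] (C : Matrix (Fin p) (Fin n) K)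
    (A : Matrix (Fin n) (Fin n) K) (x : Fin n → K) (q : Polynomial K) {d : ℕ}
    (hd : q.natDegree < d) : (C * Polynomial.aeval A q) *ᵥ x =
      ∑ j ∈ Finset.range d, q.coeff j • ((C * A ^ j) *ᵥ x) := by
  rw [Polynomial.aeval_eq_sum_range' hd, Matrix.mul_sum, Matrix.sum_mulVec]
  simp [Matrix.smul_mulVec]

/-- The system is unitriangular: the `k`-th condition is `C A^k x = 0` modulo the earlier ones, so
strong induction inverts it. -/
theorem mulVec_pow_eq_zero_iff_of_monic {n p : ℕ} {K : Type*} [Field K]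
    (C : Matrix (Fin p) (Fin n) K) (A : Matrix (Fin n) (Fin n) K) (x : Fin n → K)
    (q : Fin n → Polynomial K) (hq : ∀ k, (q k).Monic) (hd : ∀ k, (q k).natDegree = k) :
    (∀ k, (C * Polynomial.aeval A (q k)) *ᵥ x = 0) ↔ ∀ k : Fin n, (C * A ^ (k : ℕ)) *ᵥ x = 0 := by
  constructor
  · intro h k
    obtain ⟨k, hk⟩ := k
    induction k using Nat.strong_induction_on with
    | _ k ih =>
      have := h ⟨k, hk⟩
      rw [mul_aeval_mulVec C A x _ (d := k + 1) (by simp [hd]), Finset.sum_range_succ,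
        Finset.sum_eq_zero] at this
      · have hc : (q ⟨k, hk⟩).coeff k = 1 := by
          have := hq ⟨k, hk⟩
          rwa [Polynomial.Monic, Polynomial.leadingCoeff, hd] at this
        simpa [hc] using this
      · intro j hj
        have hj := Finset.mem_range.1 hj
        rw [ih j hj (hj.trans hk), smul_zero]
  · intro h k
    rw [mul_aeval_mulVec C A x _ (d := n) (by simp [hd])]
    refine Finset.sum_eq_zero fun j hj => ?_
    rw [h ⟨j, Finset.mem_range.1 hj⟩, smul_zero]

theorem mulVec_pow_eq_zero_of_lt {n p : ℕ} {K : Type*} [Field K]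
    (C : Matrix (Fin p) (Fin n) K) (A : Matrix (Fin n) (Fin n) K) (x : Fin n → K)
    (h : ∀ k : Fin n, (C * A ^ (k : ℕ)) *ᵥ x = 0) (k : ℕ) : (C * A ^ k) *ᵥ x = 0 := by
  -- For `n = 0` the characteristic polynomial is `1`, and no remainder has degree `< 0`.
  rcases n.eq_zero_or_pos with rfl | hn
  · rw [Subsingleton.elim x 0, Matrix.mulVec_zero]
  have : Nonempty (Fin n) := ⟨⟨0, hn⟩⟩
  have hd : (Polynomial.X ^ k %ₘ A.charpoly).natDegree < n := by
    have := Polynomial.natDegree_modByMonic_lt (Polynomial.X ^ k) A.charpoly_monic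
      (by intro h1; have := A.charpoly_natDegree_eq_dim; simp [h1] at this; omega)
    simpa using this
  rw [Matrix.pow_eq_aeval_mod_charpoly, mul_aeval_mulVec C A x _ hd]
  refine Finset.sum_eq_zero fun j hj => ?_
  rw [h ⟨j, Finset.mem_range.1 hj⟩, smul_zero]

/-- After the triangular reduction only the field differs: a complex vector is in the kernel of a
real matrix iff its real and imaginary parts are. -/
theorem rank_stack_pMatrix_iff {n p : ℕ} (A : Matrix (Fin n) (Fin n) ℝ)
    (C : Matrix (Fin p) (Fin n) ℝ) (lam : Fin n → ℂ) :
    (stack fun k : Fin n => C.map Complex.ofReal * pMatrix A lam k.castSucc).rank = n ↔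
      (stack fun k : Fin n => C * A ^ (k : ℕ)).rank = n := by
  choose q hq hd he using fun k : Fin n => exists_monic_aeval_eq_pMatrix A lam k.castSucc
  have hmap : ∀ k : ℕ, C.map Complex.ofReal * A.map Complex.ofReal ^ k =
      (C * A ^ k).map Complex.ofReal := by
    intro k
    have h1 : (A.map Complex.ofReal) ^ k = (A ^ k).map Complex.ofReal :=
      (map_pow (Complex.ofRealHom.mapMatrix) A k).symm
    rw [h1]
    exact (Matrix.map_mul (f := Complex.ofRealHom)).symm
  rw [rank_eq_iff_mulVec_injective, rank_eq_iff_mulVec_injective]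
  simp only [stack_mulVec_eq_zero, he]
  simp only [mulVec_pow_eq_zero_iff_of_monic _ _ _ q hq (by simpa using hd), hmap]
  constructor
  · intro h x hx
    have := h (fun i => (x i : ℂ)) (fun k => by
      ext i
      have := congrFun (hx k) i
      simp only [Matrix.mulVec, dotProduct, Matrix.map_apply, Pi.zero_apply] at this ⊢
      exact_mod_cast this)
    ext i
    exact Complex.ofReal_eq_zero.1 (congrFun this i)
  · intro h x hx
    have hre := h (fun i => (x i).re) (fun k => by
      ext i
      have := congrArg Complex.re (congrFun (hx k) i)
      simpa [Matrix.mulVec, dotProduct] using this)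
    have him := h (fun i => (x i).im) (fun k => by
      ext i
      have := congrArg Complex.im (congrFun (hx k) i)
      simpa [Matrix.mulVec, dotProduct] using this)
    ext i
    exact Complex.ext (congrFun hre i) (congrFun him i)

end NablaSystem
-- Backward jumps, nabla derivatives, and sufficiency of the rank condition.
namespace NablaSystem

variable {T : Set ℝ}

theorem rho_le (T : Set ℝ) (s : ℝ) : rho T s ≤ s := by
  unfold rho
  split_ifs with h
  · exact csSup_le h fun r hr => hr.2.le
  · exact le_rfl

theorem rho_mem (hT : IsClosed T) {s : ℝ} (hs : s ∈ T) : rho T s ∈ T := by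
  unfold rho
  split_ifs with h
  · have := csSup_mem_closure h ⟨s, fun r hr => hr.2.le⟩
    exact hT.closure_subset (closure_mono inter_subset_left this)
  · exact hs

theorem le_rho {r s : ℝ} (hr : r ∈ T) (hrs : r < s) : r ≤ rho T s := by
  have h : (T ∩ Iio s).Nonempty := ⟨r, hr, hrs⟩
  rw [rho, if_pos h]
  exact le_csSup ⟨s, fun r hr => hr.2.le⟩ ⟨hr, hrs⟩

theorem exists_mem_Ioo_of_rho_eq {r s a : ℝ} (hr : r ∈ T) (hrs : r < s) (h : rho T s = s)
    (ha : a < s) : ∃ t ∈ T, a < t ∧ t < s := by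
  by_contra! hc
  have hne : (T ∩ Iio s).Nonempty := ⟨r, hr, hrs⟩
  rw [rho, if_pos hne] at h
  have : sSup (T ∩ Iio s) ≤ a := csSup_le hne fun t ht => by
    by_contra! hat
    exact absurd ht.2 (not_lt.2 (hc t ht.1 hat))
  linarith

theorem rho_inter_Iic {s s₀ : ℝ} (h : s ≤ s₀) : rho (T ∩ Iic s₀) s = rho T s := by
  have : T ∩ Iic s₀ ∩ Iio s = T ∩ Iio s := by
    ext r
    simp only [mem_inter_iff, mem_Iic, mem_Iio]
    exact ⟨fun h => ⟨h.1.1, h.2⟩, fun hr => ⟨⟨hr.1, hr.2.le.trans h⟩, hr.2⟩⟩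
  rw [rho, rho, this]

theorem HasNablaDerivAt.sub {E : Type*} [NormedAddCommGroup E] [NormedSpace ℝ E] {f g : ℝ → E}
    {f' g' : E} {s : ℝ} (hf : HasNablaDerivAt T f f' s) (hg : HasNablaDerivAt T g g' s) :
    HasNablaDerivAt T (fun r => f r - g r) (f' - g') s := by
  intro ε hε
  obtain ⟨δ₁, h₁, hf⟩ := hf (ε / 2) (half_pos hε)
  obtain ⟨δ₂, h₂, hg⟩ := hg (ε / 2) (half_pos hε)
  refine ⟨min δ₁ δ₂, lt_min h₁ h₂, fun r hr hrs => ?_⟩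
  have e₁ := hf r hr (hrs.trans_le (min_le_left _ _))
  have e₂ := hg r hr (hrs.trans_le (min_le_right _ _))
  calc _ = ‖(f (rho T s) - f r - (rho T s - r) • f') - (g (rho T s) - g r - (rho T s - r) • g')‖ := by
        congr 1
        module
    _ ≤ _ := norm_sub_le _ _
    _ ≤ ε * |rho T s - r| := by linarith

theorem HasNablaDerivAt.clm_comp {E F : Type*} [NormedAddCommGroup E] [NormedSpace ℝ E]
    [NormedAddCommGroup F] [NormedSpace ℝ F] {f : ℝ → E} {f' : E} {s : ℝ}
    (hf : HasNablaDerivAt T f f' s) (L : E →L[ℝ] F) :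
    HasNablaDerivAt T (fun r => L (f r)) (L f') s := by
  intro ε hε
  have hL : 0 < ‖L‖ + 1 := by positivity
  obtain ⟨δ, h, hf⟩ := hf (ε / (‖L‖ + 1)) (by positivity)
  refine ⟨δ, h, fun r hr hrs => ?_⟩
  rw [← map_sub, ← map_smul, ← map_sub]
  refine (L.le_opNorm _).trans ?_
  calc _ ≤ (‖L‖ + 1) * (ε / (‖L‖ + 1) * |rho T s - r|) :=
        mul_le_mul (by linarith) (hf r hr hrs) (norm_nonneg _) hL.le
    _ = _ := by field_simp

/-- At a left-scattered `s` the values at `s` and `rho T s` determine the derivative; at a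
left-dense one, zeros accumulating from the left do. The point `a` rules out the minimum, where `rho
T s = s` holds only by convention. -/
theorem HasNablaDerivAt.eq_zero {E : Type*} [NormedAddCommGroup E] [NormedSpace ℝ E] {f : ℝ → E}
    {f' : E} {s a : ℝ} (hf : HasNablaDerivAt T f f' s) (hs : s ∈ T) (ha : a ∈ T) (has : a < s)
    (h0 : f s = 0) (hρ : f (rho T s) = 0)
    (hd : rho T s = s → ∃ b < s, ∀ r ∈ T, b < r → r < s → f r = 0) : f' = 0 := by
  rw [← norm_le_zero_iff]
  refine le_of_forall_pos_le_add fun ε hε => ?_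
  rw [zero_add]
  obtain ⟨δ, hδ, h⟩ := hf ε hε
  obtain ⟨r, hr, hrs, hr0, hne⟩ : ∃ r ∈ T, |s - r| < δ ∧ f r = 0 ∧ rho T s - r ≠ 0 := by
    rcases (rho_le T s).lt_or_eq with hlt | heq
    · exact ⟨s, hs, by simpa using hδ, h0, by linarith⟩
    · obtain ⟨b, hb, hfb⟩ := hd heq
      obtain ⟨t, ht, h1, h2⟩ := exists_mem_Ioo_of_rho_eq ha has heq
        (max_lt hb (by linarith : s - δ < s))
      rw [max_lt_iff] at h1
      refine ⟨t, ht, ?_, hfb t ht h1.1 h2, by rw [heq]; linarith⟩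
      rw [abs_lt]
      constructor <;> linarith
  have := h r hr hrs
  rw [hρ, hr0, sub_zero, zero_sub, norm_neg, norm_smul, Real.norm_eq_abs, mul_comm ε] at this
  exact le_of_mul_le_mul_left this (abs_pos.2 hne)

theorem iterate_rho_le (T : Set ℝ) (k : ℕ) (s : ℝ) : (rho T)^[k] s ≤ s := by
  induction k with
  | zero => exact le_rfl
  | succ k ih =>
    rw [Function.iterate_succ_apply']
    exact (rho_le T _).trans ih

/-- One jump from `r` cannot pass a point of `T` below `r`, and such points accumulate at `s`; so
`k` jumps started close to `s` stay above `a`. -/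
theorem exists_lt_iterate_rho (hT : IsClosed T) {s a : ℝ} (ha : a ∈ T) (has : a < s) (h : rho T s = s) (k : ℕ) :
    ∃ b < s, ∀ r ∈ T, b < r → r ≤ s → a < (rho T)^[k] r := by
  induction k with
  | zero => exact ⟨a, has, fun r _ hr _ => hr⟩
  | succ k ih =>
    obtain ⟨b, hb, hk⟩ := ih
    obtain ⟨t, ht, hbt, hts⟩ := exists_mem_Ioo_of_rho_eq ha has h hb
    refine ⟨t, hts, fun r hr htr hrs => ?_⟩
    rw [Function.iterate_succ_apply]
    exact hk _ (rho_mem hT hr) (hbt.trans_le (le_rho ht htr)) ((rho_le T r).trans hrs)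

theorem eq_iterate_rho_or_le {s s₀ : ℝ} (hs : s ∈ T) (h : s ≤ s₀) (k : ℕ) :
    (∃ j < k, (rho T)^[j] s₀ = s) ∨ s ≤ (rho T)^[k] s₀ := by
  induction k with
  | zero => exact Or.inr h
  | succ k ih =>
    rcases ih with ⟨j, hj, he⟩ | hle
    · exact Or.inl ⟨j, hj.trans k.lt_succ_self, he⟩
    · rcases hle.lt_or_eq with hlt | heq
      · rw [Function.iterate_succ_apply']
        exact Or.inr (le_rho hs hlt)
      · exact Or.inl ⟨k, k.lt_succ_self, heq.symm⟩

/-- Backward jumps skip no point of `T`. If the `k`-th iterate were at or below `s₁`, the window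
would lie among `k + 1 ≤ n` iterates. -/
theorem lt_iterate_rho_of_encard {s₁ s₀ : ℝ} {n k : ℕ}
    (hcard : ((n + 1 : ℕ) : ℕ∞) ≤ (T ∩ Icc s₁ s₀).encard) (hk : k < n) :
    s₁ < (rho T)^[k] s₀ := by
  by_contra! hle
  have hsub : T ∩ Icc s₁ s₀ ⊆ ((Finset.range (k + 1)).image fun j => (rho T)^[j] s₀ : Finset ℝ) := by
    intro s hs
    simp only [Finset.coe_image, Finset.coe_range, mem_image, mem_Iio]
    rcases eq_iterate_rho_or_le hs.1 hs.2.2 k with ⟨j, hj, he⟩ | h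
    · exact ⟨j, hj.trans k.lt_succ_self, he⟩
    · exact ⟨k, k.lt_succ_self, le_antisymm (hle.trans hs.2.1) h⟩
  have h1 := hcard.trans (encard_le_encard hsub)
  rw [encard_coe_eq_coe_finsetCard, Nat.cast_le] at h1
  have h2 := h1.trans Finset.card_image_le
  rw [Finset.card_range] at h2
  omega

theorem mulVec_pow_trajectory_eq_zero {n p : ℕ} (hT : IsClosed T)
    {A : Matrix (Fin n) (Fin n) ℝ} {C : Matrix (Fin p) (Fin n) ℝ} {s₁ : ℝ} (hs₁ : s₁ ∈ T)
    {w : ℝ → Fin n → ℝ} (hw : ∀ s ∈ T, s₁ < s → HasNablaDerivAt T w (A *ᵥ w s) s)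
    (hC : ∀ s ∈ T, s₁ < s → C *ᵥ w s = 0) (k : ℕ) :
    ∀ s ∈ T, s₁ < (rho T)^[k] s → (C * A ^ k) *ᵥ w s = 0 := by
  induction k with
  | zero => simpa using hC
  | succ k ih =>
    intro s hs hk
    have hs₁s : s₁ < s := hk.trans_le (iterate_rho_le T _ s)
    have hd := (hw s hs hs₁s).clm_comp (Matrix.mulVecLin (C * A ^ k)).toContinuousLinearMap
    simp only [LinearMap.coe_toContinuousLinearMap', Matrix.mulVecLin_apply, Matrix.mulVec_mulVec,
      Matrix.mul_assoc, ← pow_succ] at hd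
    refine hd.eq_zero hs hs₁ hs₁s (ih s hs ?_) (ih _ (rho_mem hT hs) hk) fun h => ?_
    · rw [Function.iterate_succ_apply'] at hk
      exact hk.trans_le (rho_le T _)
    · obtain ⟨b, hb, hr⟩ := exists_lt_iterate_rho hT hs₁ hs₁s h k
      exact ⟨b, hb, fun r hrT hbr hrs => ih r hrT (hr r hrT hbr hrs.le)⟩

theorem isObservableOn_of_forall_mulVec_pow {n m p : ℕ} (hT : IsClosed T)
    (A : Matrix (Fin n) (Fin n) ℝ) (B : Matrix (Fin n) (Fin m) ℝ) (C : Matrix (Fin p) (Fin n) ℝ)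
    {s₁ s₀ : ℝ} (hs₁ : s₁ ∈ T) (hs₀ : s₀ ∈ T)
    (hcard : ((n + 1 : ℕ) : ℕ∞) ≤ (T ∩ Icc s₁ s₀).encard)
    (h : ∀ x : Fin n → ℝ, (∀ k : Fin n, (C * A ^ (k : ℕ)) *ᵥ x = 0) → x = 0) :
    IsObservableOn T A B C s₁ s₀ := by
  intro v _ y z hy hz hyz
  have hle : s₁ ≤ s₀ := by
    have h1 : (T ∩ Icc s₁ s₀).encard ≠ 0 := by
      intro h0
      rw [h0] at hcard
      simp at hcard
    obtain ⟨r, hr⟩ := encard_ne_zero.1 h1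
    exact hr.2.1.trans hr.2.2
  rw [← sub_eq_zero]
  have hcl : IsClosed (T ∩ Iic s₀) := hT.inter isClosed_Iic
  refine h _ fun k => mulVec_pow_trajectory_eq_zero (T := T ∩ Iic s₀) (w := fun s => y s - z s)
    hcl ⟨hs₁, hle⟩ ?_ ?_ k s₀ ⟨hs₀, self_mem_Iic⟩ ?_
  · intro s hs hlt
    -- `s₁` is a point of `T` below `s`, so `s` is not the minimum.
    have hκ : s ∈ lowerKappa T := ⟨hs.1, fun hmin => absurd (hmin.1.2 hs₁) (not_le.2 hlt)⟩
    have := (hy s hκ hs.2).sub (hz s hκ hs.2)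
    rwa [add_sub_add_right_eq_sub, ← Matrix.mulVec_sub] at this
  · intro s hs hlt
    rw [Matrix.mulVec_sub, sub_eq_zero]
    exact hyz s ⟨hs.1, hlt, hs.2⟩
  · refine lt_iterate_rho_of_encard (n := n) ?_ k.2
    rwa [show T ∩ Iic s₀ ∩ Icc s₁ s₀ = T ∩ Icc s₁ s₀ by
      ext r; simp only [mem_inter_iff, mem_Iic, mem_Icc]; tauto]

end NablaSystem
-- Nabla integration as ordinary integration along `nextPoint`.
namespace NablaSystem

open MeasureTheory

/-- The smallest point of the time scale `T` which is at least `min τ s₀`. -/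
noncomputable def nextPoint (T : Set ℝ) (s₀ τ : ℝ) : ℝ := sInf (T ∩ Ici (min τ s₀))

section NextPoint

variable {T : Set ℝ} {s₀ : ℝ}

theorem nextPoint_mem (hT : IsClosed T) (hs₀ : s₀ ∈ T) (τ : ℝ) :
    nextPoint T s₀ τ ∈ T ∩ Ici (min τ s₀) :=
  (hT.inter isClosed_Ici).csInf_mem ⟨s₀, hs₀, mem_Ici.2 (min_le_right _ _)⟩ ⟨min τ s₀, fun _ h => h.2⟩

theorem nextPoint_le {τ r : ℝ} (hr : r ∈ T) (h : min τ s₀ ≤ r) : nextPoint T s₀ τ ≤ r :=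
  csInf_le ⟨min τ s₀, fun _ h => h.2⟩ ⟨hr, h⟩

theorem nextPoint_le_right (hs₀ : s₀ ∈ T) (τ : ℝ) : nextPoint T s₀ τ ≤ s₀ :=
  nextPoint_le hs₀ (min_le_right _ _)

theorem le_nextPoint (hT : IsClosed T) (hs₀ : s₀ ∈ T) {τ : ℝ} (h : τ ≤ s₀) :
    τ ≤ nextPoint T s₀ τ := by
  have := (nextPoint_mem hT hs₀ τ).2
  rwa [min_eq_left h] at this

theorem nextPoint_mono (hT : IsClosed T) (hs₀ : s₀ ∈ T) : Monotone (nextPoint T s₀) := by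
  intro a b hab
  have := nextPoint_mem hT hs₀ b
  exact nextPoint_le this.1 ((min_le_min_right _ hab).trans this.2)

theorem aestronglyMeasurable_comp_nextPoint {E : Type*} [NormedAddCommGroup E]
    (hT : IsClosed T) (hs₀ : s₀ ∈ T) {u : ℝ → E} (hu : Continuous u) (μ : Measure ℝ) :
    AEStronglyMeasurable (fun τ => u (nextPoint T s₀ τ)) μ :=
  hu.comp_aestronglyMeasurable (nextPoint_mono hT hs₀).measurable.aestronglyMeasurable

theorem intervalIntegrable_comp_nextPoint {E : Type*} [NormedAddCommGroup E]
    (hT : IsClosed T) (hs₀ : s₀ ∈ T) {u : ℝ → E} (hu : Continuous u) (a b : ℝ) :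
    IntervalIntegrable (fun τ => u (nextPoint T s₀ τ)) volume a b := by
  obtain ⟨M, hM⟩ := (isCompact_Icc (a := min (min a b) s₀) (b := s₀)).exists_bound_of_continuousOn
    hu.continuousOn
  refine (intervalIntegrable_const (c := M)).mono_fun'
    (aestronglyMeasurable_comp_nextPoint hT hs₀ hu _) ?_
  refine (ae_restrict_iff' measurableSet_uIoc).2 (Eventually.of_forall fun τ hτ => hM _ ⟨?_, ?_⟩)
  · exact (min_le_min_right _ hτ.1.le).trans (nextPoint_mem hT hs₀ τ).2
  · exact nextPoint_le_right hs₀ τ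

end NextPoint

/-! ### The backward Peano series, and necessity of the rank condition. -/

section Existence

variable {E : Type*} [NormedAddCommGroup E] [NormedSpace ℝ E]

/-- The terms of the backward Peano series of `y^∇ = L y`, `y s₀ = x` on the time scale `T`. -/
noncomputable def peanoTerm (T : Set ℝ) (s₀ : ℝ) (L : E →L[ℝ] E) (x : E) : ℕ → ℝ → E
  | 0, _ => x
  | k + 1, s => -∫ τ in s..s₀, L (peanoTerm T s₀ L x k (nextPoint T s₀ τ))

variable {T : Set ℝ} {s₀ : ℝ}

theorem peanoTerm_zero (L : E →L[ℝ] E) (x : E) (s : ℝ) : peanoTerm T s₀ L x 0 s = x := by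
  rw [peanoTerm]

theorem peanoTerm_succ (L : E →L[ℝ] E) (x : E) (k : ℕ) (s : ℝ) : peanoTerm T s₀ L x (k + 1) s =
    -∫ τ in s..s₀, L (peanoTerm T s₀ L x k (nextPoint T s₀ τ)) := by
  rw [peanoTerm]

theorem continuous_peanoTerm (hT : IsClosed T) (hs₀ : s₀ ∈ T) (L : E →L[ℝ] E) (x : E) (k : ℕ) :
    Continuous (peanoTerm T s₀ L x k) := by
  induction k with
  | zero => exact continuous_const
  | succ k ih =>
    have := intervalIntegral.continuous_primitive
      (intervalIntegrable_comp_nextPoint hT hs₀ (L.continuous.comp ih)) s₀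
    refine this.congr fun s => ?_
    rw [peanoTerm, intervalIntegral.integral_symm]
    rfl

/-- Since `nextPoint T s₀ τ` lies in `[τ, s₀]`, passing to it only improves the inductive bound, and
the exponential-series estimate of the case `T = ℝ` survives. -/
theorem norm_peanoTerm_le (hT : IsClosed T) (hs₀ : s₀ ∈ T) (L : E →L[ℝ] E) (x : E) (k : ℕ) {s : ℝ}
    (hs : s ≤ s₀) : ‖peanoTerm T s₀ L x k s‖ ≤ (‖L‖ * (s₀ - s)) ^ k / k.factorial * ‖x‖ := by
  induction k generalizing s with
  | zero => simp [peanoTerm]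
  | succ k ih =>
    rw [peanoTerm, norm_neg]
    have hb : ∀ τ ∈ Ioc s s₀, ‖L (peanoTerm T s₀ L x k (nextPoint T s₀ τ))‖ ≤
        ‖L‖ ^ (k + 1) / k.factorial * ‖x‖ * (s₀ - τ) ^ k := by
      intro τ hτ
      have h1 := nextPoint_le_right hs₀ τ
      have h2 := le_nextPoint hT hs₀ hτ.2
      calc _ ≤ ‖L‖ * ‖peanoTerm T s₀ L x k (nextPoint T s₀ τ)‖ := L.le_opNorm _
        _ ≤ ‖L‖ * ((‖L‖ * (s₀ - nextPoint T s₀ τ)) ^ k / k.factorial * ‖x‖) := by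
          gcongr
          exact ih h1
        _ ≤ ‖L‖ * ((‖L‖ * (s₀ - τ)) ^ k / k.factorial * ‖x‖) := by
          have : 0 ≤ s₀ - nextPoint T s₀ τ := sub_nonneg.2 h1
          gcongr
        _ = _ := by
          rw [mul_pow, pow_succ]
          ring
    refine (intervalIntegral.norm_integral_le_of_norm_le hs (Eventually.of_forall hb)
      (Continuous.intervalIntegrable (by fun_prop) _ _)).trans_eq ?_
    rw [intervalIntegral.integral_const_mul,
      intervalIntegral.integral_comp_sub_left (fun t => t ^ k) s₀, integral_pow, sub_self,
      Nat.factorial_succ, mul_pow]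
    push_cast
    have : (k.factorial : ℝ) ≠ 0 := by positivity
    field_simp
    simp

theorem norm_peanoTerm_le_of_mem_Icc (hT : IsClosed T) (hs₀ : s₀ ∈ T) (L : E →L[ℝ] E) (x : E)
    (k : ℕ) {s t : ℝ} (ht : t ∈ Icc s s₀) :
    ‖peanoTerm T s₀ L x k t‖ ≤ (‖L‖ * (s₀ - s)) ^ k / k.factorial * ‖x‖ := by
  refine (norm_peanoTerm_le hT hs₀ L x k ht.2).trans ?_
  have h1 : 0 ≤ s₀ - t := sub_nonneg.2 ht.2
  have h2 : s₀ - t ≤ s₀ - s := sub_le_sub_left ht.1 _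
  gcongr

theorem summable_peanoBound (L : E →L[ℝ] E) (x : E) (a : ℝ) :
    Summable fun k : ℕ => (‖L‖ * a) ^ k / k.factorial * ‖x‖ :=
  (Real.summable_pow_div_factorial _).mul_right _

/-- The sum of the backward Peano series. -/
noncomputable def peanoSum (T : Set ℝ) (s₀ : ℝ) (L : E →L[ℝ] E) (x : E) (s : ℝ) : E :=
  ∑' k, peanoTerm T s₀ L x k s

theorem hasSum_peanoTerm [CompleteSpace E] (hT : IsClosed T) (hs₀ : s₀ ∈ T) (L : E →L[ℝ] E)
    (x : E) {s : ℝ} (hs : s ≤ s₀) :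
    HasSum (fun k => peanoTerm T s₀ L x k s) (peanoSum T s₀ L x s) :=
  (Summable.of_norm_bounded (summable_peanoBound L x (s₀ - s))
    fun k => norm_peanoTerm_le hT hs₀ L x k hs).hasSum

theorem continuousOn_peanoSum [CompleteSpace E] (hT : IsClosed T) (hs₀ : s₀ ∈ T) (L : E →L[ℝ] E)
    (x : E) : ContinuousOn (peanoSum T s₀ L x) (Iic s₀) := by
  intro t ht
  have h1 : ContinuousOn (peanoSum T s₀ L x) (Icc (t - 1) s₀) :=
    continuousOn_tsum (fun k => (continuous_peanoTerm hT hs₀ L x k).continuousOn)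
      (summable_peanoBound L x (s₀ - (t - 1)))
      (fun k r hr => norm_peanoTerm_le_of_mem_Icc hT hs₀ L x k hr)
  refine (h1 t ⟨by linarith, ht⟩).mono_of_mem_nhdsWithin ?_
  rw [mem_nhdsWithin]
  exact ⟨Ioi (t - 1), isOpen_Ioi, by simp, fun r hr => ⟨hr.1.le, hr.2⟩⟩

theorem hasSum_integral_peanoTerm [CompleteSpace E] (hT : IsClosed T) (hs₀ : s₀ ∈ T)
    (L : E →L[ℝ] E) (x : E) {s : ℝ} (hs : s ≤ s₀) :
    HasSum (fun k => ∫ τ in s..s₀, L (peanoTerm T s₀ L x k (nextPoint T s₀ τ)))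
      (∫ τ in s..s₀, L (peanoSum T s₀ L x (nextPoint T s₀ τ))) := by
  have hb : ∀ k, ∀ τ ∈ uIoc s s₀, ‖L (peanoTerm T s₀ L x k (nextPoint T s₀ τ))‖ ≤
      ‖L‖ * ((‖L‖ * (s₀ - s)) ^ k / k.factorial * ‖x‖) := by
    intro k τ hτ
    rw [uIoc_of_le hs] at hτ
    refine (L.le_opNorm _).trans (mul_le_mul_of_nonneg_left
      (norm_peanoTerm_le_of_mem_Icc hT hs₀ L x k ⟨?_, nextPoint_le_right hs₀ τ⟩) (norm_nonneg _))
    exact hτ.1.le.trans (le_nextPoint hT hs₀ hτ.2)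
  refine intervalIntegral.hasSum_integral_of_dominated_convergence
    (fun k _ => ‖L‖ * ((‖L‖ * (s₀ - s)) ^ k / k.factorial * ‖x‖)) (fun k => ?_)
    (fun k => Eventually.of_forall (hb k)) (Eventually.of_forall fun τ _ => ?_)
    intervalIntegrable_const (Eventually.of_forall fun τ _ => ?_)
  · exact aestronglyMeasurable_comp_nextPoint hT hs₀
      (L.continuous.comp (continuous_peanoTerm hT hs₀ L x k)) _
  · exact (summable_peanoBound L x (s₀ - s)).mul_left _
  · exact (hasSum_peanoTerm hT hs₀ L x (nextPoint_le_right hs₀ τ)).mapL L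

theorem peanoSum_eq [CompleteSpace E] (hT : IsClosed T) (hs₀ : s₀ ∈ T) (L : E →L[ℝ] E) (x : E)
    {s : ℝ} (hs : s ≤ s₀) : peanoSum T s₀ L x s =
      x - ∫ τ in s..s₀, L (peanoSum T s₀ L x (nextPoint T s₀ τ)) := by
  have h1 : HasSum (fun k => peanoTerm T s₀ L x (k + 1) s)
      (-∫ τ in s..s₀, L (peanoSum T s₀ L x (nextPoint T s₀ τ))) := by
    simp_rw [peanoTerm_succ]
    exact (hasSum_integral_peanoTerm hT hs₀ L x hs).neg
  have h2 := h1.zero_add (f := fun k => peanoTerm T s₀ L x k s)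
  rw [peanoTerm_zero, ← sub_eq_add_neg] at h2
  exact (hasSum_peanoTerm hT hs₀ L x hs).unique h2

theorem exists_continuous_integral_eq [CompleteSpace E] (hT : IsClosed T) (hs₀ : s₀ ∈ T)
    (L : E →L[ℝ] E) (x : E) : ∃ Y : ℝ → E, Continuous Y ∧
      ∀ s ≤ s₀, Y s = x - ∫ τ in s..s₀, L (Y (nextPoint T s₀ τ)) := by
  -- The series is controlled only for `s ≤ s₀`; freezing it beyond `s₀` makes it continuous on all
  -- of `ℝ`.
  refine ⟨fun s => peanoSum T s₀ L x (min s s₀), (continuousOn_peanoSum hT hs₀ L x).comp_continuous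
    (by fun_prop) fun s => mem_Iic.2 (min_le_right _ _), fun s hs => ?_⟩
  simp only [min_eq_left (nextPoint_le_right hs₀ _), min_eq_left hs]
  exact peanoSum_eq hT hs₀ L x hs

/-- In a gap `(rho T s, s]` the next point is `s` itself, and otherwise it stays between `τ` and the
larger of `r` and `s`. Hence the integrand for the increment from `r` to `rho T s` is sampled near
`s`. -/
theorem abs_nextPoint_sub_le (hT : IsClosed T) (hs₀ : s₀ ∈ T) {s r τ : ℝ} (hs : s ∈ T)
    (hss₀ : s ≤ s₀) (hr : r ∈ T) (hrs₀ : r ≤ s₀) (h : rho T s = s ∨ rho T s < r)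
    (hτ : τ ∈ uIoc r (rho T s)) : |nextPoint T s₀ τ - s| ≤ |r - s| := by
  have hρ := rho_le T s
  have hτ₀ : τ ≤ s₀ := hτ.2.trans (max_le hrs₀ (hρ.trans hss₀))
  have hle := le_nextPoint hT hs₀ hτ₀
  have hmin : ∀ {t}, τ ≤ t → min τ s₀ ≤ t := fun h => (min_le_left _ _).trans h
  rcases hρ.lt_or_eq with hlt | heq
  · have hρr := h.resolve_left hlt.ne
    rw [uIoc_of_ge hρr.le] at hτ
    have h1 : s ≤ nextPoint T s₀ τ := by
      by_contra! hc
      have := le_rho (nextPoint_mem hT hs₀ τ).1 hc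
      linarith [hτ.1]
    have h2 : nextPoint T s₀ τ ≤ r := nextPoint_le hr (hmin hτ.2)
    rw [abs_of_nonneg (by linarith), abs_of_nonneg (by linarith)]
    linarith
  · rw [heq] at hτ
    rcases le_total r s with hrs | hrs
    · rw [uIoc_of_le hrs] at hτ
      have h2 : nextPoint T s₀ τ ≤ s := nextPoint_le hs (hmin hτ.2)
      rw [abs_of_nonpos (by linarith), abs_of_nonpos (by linarith)]
      linarith [hτ.1]
    · rw [uIoc_of_ge hrs] at hτ
      have h2 : nextPoint T s₀ τ ≤ r := nextPoint_le hr (hmin hτ.2)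
      rw [abs_of_nonneg (by linarith [hτ.1]), abs_of_nonneg (by linarith)]
      linarith

/-- Existence of backward solutions of linear equations with constant coefficients on an arbitrary
time scale. -/
theorem exists_hasNablaDerivAt_eq_clm_apply [CompleteSpace E] (hT : IsClosed T) (hs₀ : s₀ ∈ T)
    (L : E →L[ℝ] E) (x : E) : ∃ Y : ℝ → E, Y s₀ = x ∧
      ∀ s ∈ T, s ≤ s₀ → HasNablaDerivAt (T ∩ Iic s₀) Y (L (Y s)) s := by
  obtain ⟨Y, hY, hint⟩ := exists_continuous_integral_eq hT hs₀ L x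
  refine ⟨Y, by simpa using hint s₀ le_rfl, fun s hs hss₀ ε hε => ?_⟩
  rw [rho_inter_Iic hss₀]
  have hLY : Continuous fun t => L (Y t) := L.continuous.comp hY
  have hI := intervalIntegrable_comp_nextPoint hT hs₀ hLY
  obtain ⟨δ, hδ, hc⟩ := Metric.continuous_iff.1 hLY s ε hε
  have hρ := rho_le T s
  -- At a left-scattered point `δ'` is at most the gap, forcing `r` to lie above `rho T s`.
  obtain ⟨δ', hδ', hδδ', hscat⟩ : ∃ δ' > 0, δ' ≤ δ ∧ (rho T s = s ∨ δ' ≤ s - rho T s) := by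
    rcases hρ.lt_or_eq with hlt | heq
    · exact ⟨min δ (s - rho T s), lt_min hδ (sub_pos.2 hlt), min_le_left _ _,
        Or.inr (min_le_right _ _)⟩
    · exact ⟨δ, hδ, le_rfl, Or.inl heq⟩
  refine ⟨δ', hδ', fun r hr hrs => ?_⟩
  have hρr : rho T s = s ∨ rho T s < r :=
    hscat.imp_right fun h => by linarith [(abs_lt.1 hrs).2]
  have hdiff : Y (rho T s) - Y r - (rho T s - r) • L (Y s) =
      ∫ τ in r..rho T s, (L (Y (nextPoint T s₀ τ)) - L (Y s)) := by
    rw [intervalIntegral.integral_sub (hI _ _) intervalIntegrable_const,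
      intervalIntegral.integral_const, hint _ (hρ.trans hss₀), hint r hr.2,
      ← intervalIntegral.integral_add_adjacent_intervals (hI r (rho T s)) (hI (rho T s) s₀)]
    abel
  rw [hdiff]
  refine intervalIntegral.norm_integral_le_of_norm_le_const fun τ hτ => ?_
  rw [← dist_eq_norm]
  refine (hc _ ?_).le
  rw [Real.dist_eq]
  refine (abs_nextPoint_sub_le hT hs₀ hs hss₀ hr.1 hr.2 hρr hτ).trans_lt ?_
  rw [abs_sub_comm]
  exact hrs.trans_le hδδ'

end Existence

/-- The unobservable subspace of the pair `(A, C)`. -/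
def unobservableSubspace {n p : ℕ} (A : Matrix (Fin n) (Fin n) ℝ) (C : Matrix (Fin p) (Fin n) ℝ) :
    Submodule ℝ (Fin n → ℝ) :=
  ⨅ k : ℕ, LinearMap.ker (C * A ^ k).mulVecLin

theorem mem_unobservableSubspace {n p : ℕ} {A : Matrix (Fin n) (Fin n) ℝ}
    {C : Matrix (Fin p) (Fin n) ℝ} {x : Fin n → ℝ} :
    x ∈ unobservableSubspace A C ↔ ∀ k : ℕ, (C * A ^ k) *ᵥ x = 0 := by
  simp [unobservableSubspace]

theorem mulVec_mem_unobservableSubspace {n p : ℕ} {A : Matrix (Fin n) (Fin n) ℝ}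
    {C : Matrix (Fin p) (Fin n) ℝ} {x : Fin n → ℝ} (hx : x ∈ unobservableSubspace A C) :
    A.mulVecLin x ∈ unobservableSubspace A C := by
  rw [mem_unobservableSubspace] at hx ⊢
  intro k
  rw [Matrix.mulVecLin_apply, Matrix.mulVec_mulVec, Matrix.mul_assoc, ← pow_succ]
  exact hx (k + 1)

theorem IsObservableOn.eq_zero {n m p : ℕ} {T : Set ℝ} (hT : IsClosed T)
    {A : Matrix (Fin n) (Fin n) ℝ} {B : Matrix (Fin n) (Fin m) ℝ} {C : Matrix (Fin p) (Fin n) ℝ}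
    {s₁ s₀ : ℝ} (hs₀ : s₀ ∈ T) (hobs : IsObservableOn T A B C s₁ s₀) {x : Fin n → ℝ}
    (hx : x ∈ unobservableSubspace A C) : x = 0 := by
  -- Solving inside the invariant subspace makes `C Y = 0` automatic; no uniqueness of solutions is
  -- needed.
  obtain ⟨Y, hY₀, hY⟩ := exists_hasNablaDerivAt_eq_clm_apply hT hs₀
    (A.mulVecLin.restrict fun _ => mulVec_mem_unobservableSubspace).toContinuousLinearMap
    (⟨x, hx⟩ : unobservableSubspace A C)
  have h := hobs 0
    (fun s _ => ⟨fun _ => continuousWithinAt_const, fun _ => ⟨0, tendsto_const_nhds⟩⟩)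
    (fun s => (Y s : Fin n → ℝ)) 0 ?_ ?_ ?_
  · simpa [hY₀] using h
  · intro s hs hss₀
    have := (hY s hs.1 hss₀).clm_comp (unobservableSubspace A C).subtypeL
    simpa using this
  · intro s _ _ ε hε
    refine ⟨1, one_pos, fun r _ _ => ?_⟩
    simp only [Pi.zero_apply, Matrix.mulVec_zero, add_zero, smul_zero, sub_zero, norm_zero]
    positivity
  · intro s _
    simpa using mem_unobservableSubspace.1 (Y s).2 0

end NablaSystem

open NablaSystem in
theorem theorem5p2 {n m p : ℕ} (T : Set ℝ) (hT : IsTimeScale T)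
    (A : Matrix (Fin n) (Fin n) ℝ) (B : Matrix (Fin n) (Fin m) ℝ) (C : Matrix (Fin p) (Fin n) ℝ)
    (s₁ s₀ : ℝ) (hs₁ : s₁ ∈ T) (hs₀ : s₀ ∈ T)
    (hcard : ((n + 1 : ℕ) : ℕ∞) ≤ (T ∩ Set.Icc s₁ s₀).encard)
    (lam : Fin n → ℂ) (hlam : IsEigenvalueList A lam) :
    List.TFAE [
      IsObservableOn T A B C s₁ s₀,
      (stack fun k : Fin n => C.map Complex.ofReal * pMatrix A lam k.castSucc).rank = n,
      (stack fun k : Fin n => C * A ^ (k : ℕ)).rank = n] := by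
  tfae_have 2 ↔ 3 := rank_stack_pMatrix_iff A C lam
  tfae_have 1 → 3 := by
    intro hobs
    rw [rank_eq_iff_mulVec_injective]
    intro x hx
    rw [stack_mulVec_eq_zero] at hx
    exact hobs.eq_zero hT.2 hs₀
      (mem_unobservableSubspace.2 (mulVec_pow_eq_zero_of_lt C A x hx))
  tfae_have 3 → 1 := by
    intro hrank
    rw [rank_eq_iff_mulVec_injective] at hrank
    exact isObservableOn_of_forall_mulVec_pow hT.2 A B C hs₁ hs₀ hcard fun x hx =>
      hrank x ((stack_mulVec_eq_zero _ x).2 hx)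
  tfae_finish
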